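/- Let $K$ be a compact metrizable space and let $F:K\to\mathbb R$ be a bounded function. For a closed set $L\subseteq K$ and $\ell\in L$, let $$\operatorname{osc}_L(F,\ell)=\inf_{U}\ \sup\{F(\ell_1)-F(\ell_2):\ell_1,\ell_2\in U\cap L\},$$ where $U$ runs over the neighbourhoods of $\ell$ in $K$. For $\delta>0$ define $K_0(F,\delta)=K$, $$K_{\alpha+1}(F,\delta)=\{k\in K_\alpha(F,\delta):\operatorname{osc}_{K_\alpha(F,\delta)}(F,k)\ge\delta\},\qquad K_\alpha(F,\delta)=\bigcap_{\beta<\alpha}K_\beta(F,\delta)\ \text{ for limit ordinals }\alpha.$$ Let $\beta(F,\delta)$ be the least $\alpha<\omega_1$ with $K_\alpha(F,\delta)=\emptyset$ if such an $\alpha$ exists, and $\beta(F,\delta)=\omega_1$ otherwise. Put $\beta(F)=\sup_{\delta>0}\beta(F,\delta)$. A Banach space $Q$, identified with its canonical image in $Q^{**}$, is quasi-reflexive of order $1$ if $\dim(Q^{**}/Q)=1$. **Proposition 2.8.** For every ordinal $\gamma<\omega_1$ there exist a separable real Banach space $Q_\gamma$ that is quasi-reflexive of order $1$ and an element $F_\gamma\in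 Q_\gamma^{**}$ such that $$Q_\gamma^{**}=Q_\gamma\oplus\langle F_\gamma\rangle\qquad\text{and}\qquad \beta(F_\gamma)>\gamma,$$ where $\beta(F_\gamma)$ is the index of the restriction of $F_\gamma$ to the closed unit ball $\mathrm{Ba}(Q_\gamma^*)$ of $Q_\gamma^*$ with its weak* topology (compact and metrizable, since $Q_\gamma$ is separable). -/

import Mathlib

open scoped Ordinal

noncomputable section

/-- The transfinite derivation `K_α(F, δ)`: `K_0 = K`, `K_{α+1}` is the set of the points of `K_α`
at which the oscillation of the restriction of `F` to `K_α` is at least `δ`, and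
`K_α = ⋂_{β < α} K_β` at limit ordinals.  The oscillation
`lim_{ε ↓ 0} sup {F l₁ - F l₂ | l₁, l₂ ∈ L, d(l₁, l) < ε, d(l₂, l) < ε}` depends on the metric of
`K` only through the topology: it is the infimum over the neighbourhoods `U` of `l` in `L` of the
diameter of `F(U)`, which is `oscillationWithin F L l`. -/
def oscDerivedSet {K : Type*} [TopologicalSpace K] (F : K → ℝ) (δ : ℝ) (α : Ordinal.{0}) : Set K :=
  Ordinal.limitRecOn α
    Set.univ
    (fun _ L => {k | k ∈ L ∧ ENNReal.ofReal δ ≤ oscillationWithin F L k})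
    (fun o _ L => ⋂ (β : Ordinal.{0}) (h : β < o), L β h)

/-- The index `β(F, δ)`: the least `α < ω₁` with `K_α(F, δ) = ∅`, or `ω₁` if there is none. -/
def oscIndexAt {K : Type*} [TopologicalSpace K] (F : K → ℝ) (δ : ℝ) : Ordinal.{0} :=
  sInf ({α : Ordinal.{0} | α < ω₁ ∧ oscDerivedSet F δ α = ∅} ∪ {ω₁})

/-- The oscillation index `β(F) = sup_{δ > 0} β(F, δ)`. -/
def oscIndex {K : Type*} [TopologicalSpace K] (F : K → ℝ) : Ordinal.{0} :=
  ⨆ δ : Set.Ioi (0 : ℝ), oscIndexAt F δ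

/-- The closed unit ball of `X*`, with the weak* topology (the subspace topology of `WeakDual`). -/
abbrev WeakStarBall (X : Type*) [NormedAddCommGroup X] [NormedSpace ℝ X] : Type _ :=
  {f : WeakDual ℝ X // ‖WeakDual.toStrongDual f‖ ≤ 1}

/-- The restriction of an element of `X**` to the closed unit ball of `X*`. -/
def bidualRestrict {X : Type*} [NormedAddCommGroup X] [NormedSpace ℝ X]
    (F : StrongDual ℝ (StrongDual ℝ X)) : WeakStarBall X → ℝ :=
  fun f => F (WeakDual.toStrongDual f.1)

/-- The canonical image of `X` in `X**`. -/
abbrev canonicalImage (X : Type*) [NormedAddCommGroup X] [NormedSpace ℝ X] :=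
  LinearMap.range (NormedSpace.inclusionInDoubleDual ℝ X).toLinearMap

/-- `X` is quasi-reflexive of order `n`: `dim (X** / X) = n`. -/
def IsQuasiReflexiveOfOrder (X : Type*) [NormedAddCommGroup X] [NormedSpace ℝ X] (n : ℕ) : Prop :=
  Module.rank ℝ (StrongDual ℝ (StrongDual ℝ X) ⧸ canonicalImage X) = n

end

noncomputable section

namespace PathSpace

open Filter Topology

/-- The cost of a weighted block decomposition on `[m, n)`: the sum of the squares of the weights at
the points where a block starts. -/
def cost (c : ℕ → ℝ) (s : ℕ → Bool) (m n : ℕ) : ℝ :=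
  ∑ p ∈ Finset.Ico m n, if s p then c p ^ 2 else 0

/-- The raw data `(c, s, σ, l)` of a path: weights, block starts, the on/off switch, labels. -/
abbrev PathData : Type := (ℕ → ℝ) × (ℕ → Bool) × (ℕ → Bool) × (ℕ → ℕ)

/-- A path is admissible for the ranking `r` of the labels if its weights are constant on blocks and
lie in the unit ball of `ℓ²`, and if within a block the rank of the label never increases, and drops
whenever the path is switched on. -/
structure Admissible (r : ℕ → Ordinal.{0}) (t : PathData) : Prop where
  start : t.2.1 0 = true
  label_le : ∀ p, t.2.2.2 p ≤ p
  cost_le : ∀ N, cost t.1 t.2.1 0 N ≤ 1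
  weight : ∀ p, t.2.1 (p + 1) = false → t.1 (p + 1) = t.1 p
  rank_le : ∀ p, t.2.1 (p + 1) = false → r (t.2.2.2 (p + 1)) ≤ r (t.2.2.2 p)
  rank_lt : ∀ p, t.2.1 (p + 1) = false → t.2.2.1 p = false → t.2.2.1 (p + 1) = true →
    r (t.2.2.2 (p + 1)) < r (t.2.2.2 p)

/-- The coefficient of a path at `p`. -/
def coef (t : PathData) (p : ℕ) : ℝ := if t.2.2.1 p then t.1 p else 0

/-- The path that follows `w₁ • t₁` before `n` and `w₂ • t₂` from `n` on, with a new block at `n`. -/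
def concat (n : ℕ) (w₁ w₂ : ℝ) (t₁ t₂ : PathData) : PathData :=
  (fun p => if p < n then w₁ * t₁.1 p else w₂ * t₂.1 p,
   fun p => if p < n then t₁.2.1 p else if p = n then true else t₂.2.1 p,
   fun p => if p < n then t₁.2.2.1 p else t₂.2.2.1 p,
   fun p => if p < n then t₁.2.2.2 p else t₂.2.2.2 p)

lemma coef_concat (n : ℕ) (w₁ w₂ : ℝ) (t₁ t₂ : PathData) (p : ℕ) :
    coef (concat n w₁ w₂ t₁ t₂) p = if p < n then w₁ * coef t₁ p else w₂ * coef t₂ p := by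
  unfold coef concat
  by_cases h : p < n <;> simp [h]

lemma cost_mono_right (c : ℕ → ℝ) (s : ℕ → Bool) (m : ℕ) {n n' : ℕ} (h : n ≤ n') :
    cost c s m n ≤ cost c s m n' := by
  apply Finset.sum_le_sum_of_subset_of_nonneg (Finset.Ico_subset_Ico le_rfl h)
  intro p _ _
  split_ifs <;> positivity

lemma cost_nonneg (c : ℕ → ℝ) (s : ℕ → Bool) (m n : ℕ) : 0 ≤ cost c s m n := by
  apply Finset.sum_nonneg
  intro p _
  split_ifs <;> positivity

lemma cost_add (c : ℕ → ℝ) (s : ℕ → Bool) {m n k : ℕ} (h : m ≤ n) (h' : n ≤ k) :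
    cost c s m n + cost c s n k = cost c s m k :=
  Finset.sum_Ico_consecutive _ h h'

variable {r : ℕ → Ordinal.{0}}

namespace Admissible

variable {t t₁ t₂ : PathData}

lemma sq_weight_le_cost (ht : Admissible r t) (n : ℕ) : t.1 n ^ 2 ≤ cost t.1 t.2.1 0 (n + 1) := by
  induction n with
  | zero => simp [cost, ht.start]
  | succ n ih =>
    rw [cost, Finset.sum_Ico_succ_top (Nat.zero_le _)]
    cases hs : t.2.1 (n + 1) with
    | false => simpa [ht.weight n hs, cost] using ih
    | true =>
      have := cost_nonneg t.1 t.2.1 0 (n + 1)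
      rw [cost] at this
      simpa using this

lemma sq_weight_add_cost_le (ht : Admissible r t) {n N : ℕ} (h : n < N) :
    t.1 n ^ 2 + cost t.1 t.2.1 (n + 1) N ≤ 1 := by
  have h1 := ht.sq_weight_le_cost n
  have h2 := cost_add t.1 t.2.1 (Nat.zero_le (n + 1)) (Nat.succ_le_of_lt h)
  have h3 := ht.cost_le N
  linarith

lemma abs_weight_le (ht : Admissible r t) (n : ℕ) : |t.1 n| ≤ 1 := by
  have := (ht.sq_weight_le_cost n).trans (ht.cost_le _)
  exact abs_le_one_iff_mul_self_le_one.2 (by nlinarith)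

lemma concat_of_cost (h₁ : Admissible r t₁) (h₂ : Admissible r t₂) (n : ℕ) (w₁ w₂ : ℝ)
    (hw : ∀ N, n < N → w₁ ^ 2 * cost t₁.1 t₁.2.1 0 n +
      w₂ ^ 2 * (t₂.1 n ^ 2 + cost t₂.1 t₂.2.1 (n + 1) N) ≤ 1) :
    Admissible r (concat n w₁ w₂ t₁ t₂) where
  start := by
    rcases Nat.eq_zero_or_pos n with rfl | h
    · simp [concat]
    · simp [concat, h, h₁.start]
  label_le p := by
    by_cases h : p < n <;> simp [concat, h, h₁.label_le, h₂.label_le]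
  cost_le := by
    have key : ∀ N, n < N → cost (concat n w₁ w₂ t₁ t₂).1 (concat n w₁ w₂ t₁ t₂).2.1 0 N ≤ 1 := by
      intro N hN
      refine le_trans (le_of_eq ?_) (hw N hN)
      rw [← cost_add _ _ (Nat.zero_le n) hN.le]
      congr 1
      · rw [cost, cost, Finset.mul_sum]
        refine Finset.sum_congr rfl fun p hp => ?_
        have : p < n := (Finset.mem_Ico.1 hp).2
        simp [concat, this, mul_pow]
      · rw [cost, Finset.sum_eq_sum_Ico_succ_bot hN, mul_add, cost, Finset.mul_sum]
        congr 1
        · simp [concat, mul_pow]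
        · refine Finset.sum_congr rfl fun p hp => ?_
          have h := (Finset.mem_Ico.1 hp).1
          have h1 : ¬ p < n := by omega
          have h2 : p ≠ n := by omega
          simp [concat, h1, h2, mul_pow]
    intro N
    exact (cost_mono_right _ _ _ (le_max_left N (n + 1))).trans (key _ (by omega))
  weight p hp := by
    rcases lt_trichotomy (p + 1) n with h | h | h
    · have h' : p < n := by omega
      simp only [concat, h, if_true] at hp
      simp [concat, h, h', h₁.weight p hp]
    · simp [concat, h] at hp
    · have h' : ¬ p < n := by omega
      have h'' : ¬ p + 1 < n := by omega
      have h3 : p + 1 ≠ n := by omega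
      simp only [concat, h'', h3, if_false] at hp
      simp [concat, h', h'', h₂.weight p hp]
  rank_le p hp := by
    rcases lt_trichotomy (p + 1) n with h | h | h
    · have h' : p < n := by omega
      simp only [concat, h, if_true] at hp
      simp [concat, h, h', h₁.rank_le p hp]
    · simp [concat, h] at hp
    · have h' : ¬ p < n := by omega
      have h'' : ¬ p + 1 < n := by omega
      have h3 : p + 1 ≠ n := by omega
      simp only [concat, h'', h3, if_false] at hp
      simp [concat, h', h'', h₂.rank_le p hp]
  rank_lt p hp := by
    rcases lt_trichotomy (p + 1) n with h | h | h
    · have h' : p < n := by omega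
      simp only [concat, h, if_true] at hp
      simpa [concat, h, h'] using h₁.rank_lt p hp
    · simp [concat, h] at hp
    · have h' : ¬ p < n := by omega
      have h'' : ¬ p + 1 < n := by omega
      have h3 : p + 1 ≠ n := by omega
      simp only [concat, h'', h3, if_false] at hp
      simpa [concat, h', h''] using h₂.rank_lt p hp

lemma concat (h₁ : Admissible r t₁) (h₂ : Admissible r t₂) (n : ℕ) {w₁ w₂ : ℝ}
    (hw : w₁ ^ 2 + w₂ ^ 2 ≤ 1) : Admissible r (concat n w₁ w₂ t₁ t₂) := by
  refine h₁.concat_of_cost h₂ n w₁ w₂ fun N hN => ?_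
  have h3 := h₁.cost_le n
  have h4 := h₂.sq_weight_add_cost_le hN
  have := mul_le_mul_of_nonneg_left h3 (sq_nonneg w₁)
  have := mul_le_mul_of_nonneg_left h4 (sq_nonneg w₂)
  linarith

lemma rescale_tail (ht : Admissible r t) {n : ℕ} (hs : t.2.1 n = true) {ε : ℝ} (hε : 0 < ε)
    (hc : ∀ N, cost t.1 t.2.1 n N ≤ ε ^ 2) : Admissible r (PathSpace.concat n 0 ε⁻¹ t t) := by
  refine ht.concat_of_cost ht n 0 ε⁻¹ fun N hN => ?_
  have h := hc N
  rw [cost, Finset.sum_eq_sum_Ico_succ_bot hN, hs, if_pos rfl] at h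
  have h' : t.1 n ^ 2 + cost t.1 t.2.1 (n + 1) N ≤ ε ^ 2 := h
  calc _ = (ε⁻¹) ^ 2 * (t.1 n ^ 2 + cost t.1 t.2.1 (n + 1) N) := by ring
    _ ≤ (ε⁻¹) ^ 2 * ε ^ 2 := by gcongr
    _ = 1 := by rw [← mul_pow, inv_mul_cancel₀ hε.ne', one_pow]

end Admissible

variable (r) in
/-- The set of admissible paths. -/
def paths : Set PathData := {t | Admissible r t}

lemma isClosed_paths : IsClosed (paths r) := by
  have hs : ∀ p, Continuous fun t : PathData => t.2.1 p := fun p => by fun_prop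
  have hσ : ∀ p, Continuous fun t : PathData => t.2.2.1 p := fun p => by fun_prop
  have hl : ∀ p, Continuous fun t : PathData => t.2.2.2 p := fun p => by fun_prop
  have hc : ∀ p, Continuous fun t : PathData => t.1 p := fun p => by fun_prop
  have hso : ∀ p, IsOpen {t : PathData | t.2.1 (p + 1) = false} := fun p =>
    (isOpen_discrete {false}).preimage (hs (p + 1))
  have e : paths r = {t | t.2.1 0 = true} ∩ {t | ∀ p, t.2.2.2 p ≤ p} ∩
      {t | ∀ N, cost t.1 t.2.1 0 N ≤ 1} ∩ {t | ∀ p, t.2.1 (p + 1) = false → t.1 (p + 1) = t.1 p} ∩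
      {t | ∀ p, t.2.1 (p + 1) = false → r (t.2.2.2 (p + 1)) ≤ r (t.2.2.2 p)} ∩
      {t | ∀ p, t.2.1 (p + 1) = false → t.2.2.1 p = false → t.2.2.1 (p + 1) = true →
        r (t.2.2.2 (p + 1)) < r (t.2.2.2 p)} := by
    ext t
    constructor
    · intro h
      exact ⟨⟨⟨⟨⟨h.1, h.2⟩, h.3⟩, h.4⟩, h.5⟩, h.6⟩
    · rintro ⟨⟨⟨⟨⟨h1, h2⟩, h3⟩, h4⟩, h5⟩, h6⟩
      exact ⟨h1, h2, h3, h4, h5, h6⟩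
  rw [e]
  refine ((((IsClosed.inter ?_ ?_).inter ?_).inter ?_).inter ?_).inter ?_
  · exact (isClosed_discrete {true}).preimage (hs 0)
  · simp only [Set.ofPred_forall]
    exact isClosed_iInter fun p => (isClosed_discrete (Set.Iic p)).preimage (hl p)
  · simp only [Set.ofPred_forall]
    refine isClosed_iInter fun N => isClosed_le ?_ continuous_const
    unfold cost
    refine continuous_finsetSum _ fun p _ => ?_
    have : Continuous fun t : PathData => (if t.2.1 p then (1 : ℝ) else 0) * t.1 p ^ 2 :=
      ((continuous_of_discreteTopology (f := fun b : Bool => if b then (1 : ℝ) else 0)).comp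
        (hs p)).mul ((hc p).pow 2)
    convert this using 2 with t
    split_ifs <;> simp
  · simp only [Set.ofPred_forall]
    exact isClosed_iInter fun p => isClosed_imp (hso p) (isClosed_eq (hc _) (hc _))
  · simp only [Set.ofPred_forall]
    exact isClosed_iInter fun p => isClosed_imp (hso p)
      ((isClosed_discrete {x : ℕ × ℕ | r x.1 ≤ r x.2}).preimage ((hl (p + 1)).prodMk (hl p)))
  · simp only [Set.ofPred_forall]
    exact isClosed_iInter fun p => isClosed_imp (hso p) <|
      isClosed_imp ((isOpen_discrete {false}).preimage (hσ p)) <|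
      isClosed_imp ((isOpen_discrete {true}).preimage (hσ (p + 1)))
      ((isClosed_discrete {x : ℕ × ℕ | r x.1 < r x.2}).preimage ((hl (p + 1)).prodMk (hl p)))

lemma isCompact_paths : IsCompact (paths r) := by
  have h : IsCompact ((Set.univ.pi fun _ : ℕ => Set.Icc (-1 : ℝ) 1) ×ˢ
      (Set.univ : Set (ℕ → Bool)) ×ˢ (Set.univ : Set (ℕ → Bool)) ×ˢ
      (Set.univ.pi fun p : ℕ => Set.Iic p)) :=
    (isCompact_univ_pi fun _ => isCompact_Icc).prod <| isCompact_univ.prod <|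
      isCompact_univ.prod <| isCompact_univ_pi fun p => (Set.finite_Iic p).isCompact
  refine h.of_isClosed_subset isClosed_paths fun t ht => ?_
  exact ⟨fun p _ => abs_le.1 (Admissible.abs_weight_le ht p), trivial, trivial,
    fun p _ => Admissible.label_le ht p⟩

instance : CompactSpace (paths r) := isCompact_iff_compactSpace.1 isCompact_paths

lemma abs_coef_le {t : PathData} (ht : Admissible r t) (p : ℕ) : |coef t p| ≤ 1 := by
  unfold coef
  split_ifs
  · exact ht.abs_weight_le p
  · simp

lemma continuous_coef (p : ℕ) : Continuous fun t : PathData => coef t p := by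
  have : Continuous fun t : PathData => (if t.2.2.1 p then (1 : ℝ) else 0) * t.1 p :=
    ((continuous_of_discreteTopology (f := fun b : Bool => if b then (1 : ℝ) else 0)).comp
      (show Continuous fun t : PathData => t.2.2.1 p by fun_prop)).mul (by fun_prop)
  convert this using 2 with t
  unfold coef
  split_ifs <;> simp

/-- The path that is on exactly from `n` on, with weight `1` there. -/
def stepPath (n : ℕ) : PathData :=
  (fun p => if p < n then 0 else 1, fun p => p = 0 ∨ p = n, fun _ => true, fun _ => 0)

lemma coef_stepPath (n p : ℕ) : coef (stepPath n) p = if p < n then 0 else 1 := by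
  simp [coef, stepPath]

lemma admissible_stepPath (n : ℕ) : Admissible r (stepPath n) where
  start := by simp [stepPath]
  label_le p := by simp [stepPath]
  cost_le N := by
    have : ∀ p ∈ Finset.Ico 0 N, (if (stepPath n).2.1 p then (stepPath n).1 p ^ 2 else 0) =
        if p = n then (1 : ℝ) else 0 := by
      intro p _
      by_cases h : p = n
      · simp [stepPath, h]
      · by_cases h0 : p = 0
        · have : 0 < n := by omega
          simp [stepPath, h0, this, this.ne]
        · simp [stepPath, h, h0]
    rw [cost, Finset.sum_congr rfl this, Finset.sum_ite_eq']
    split_ifs <;> norm_num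
  weight p hp := by
    simp only [stepPath, Nat.add_eq_zero_iff, one_ne_zero, and_false, false_or,
      decide_eq_false_iff_not] at hp
    by_cases h : p < n
    · have : p + 1 < n := by omega
      simp [stepPath, h, this]
    · have : ¬ p + 1 < n := by omega
      simp [stepPath, h, this]
  rank_le p _ := le_rfl
  rank_lt p _ h := by simp [stepPath] at h

/-- The path that is on exactly from `n` on, as a point of the path space. -/
def step (n : ℕ) : paths r := ⟨stepPath n, admissible_stepPath n⟩

instance : Nonempty (paths r) := ⟨step 0⟩

/-- The coefficients of a path are eventually constant, or the path has blocks of arbitrarily small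
remaining cost. -/
lemma Admissible.eventually_const_or {t : PathData} (ht : Admissible r t) :
    (∃ n k, ∀ p, n ≤ p → coef t p = k) ∨
      ∀ ε : ℝ, 0 < ε → ∃ n, t.2.1 n = true ∧ ∀ N, cost t.1 t.2.1 n N ≤ ε ^ 2 := by
  by_cases hfin : ∃ n, ∀ p, n ≤ p → t.2.1 (p + 1) = false
  · left
    obtain ⟨n, hn⟩ := hfin
    have hc : ∀ p, n ≤ p → t.1 p = t.1 n := fun p hp => by
      induction p, hp using Nat.le_induction with
      | base => rfl
      | succ p hp ih => rw [ht.weight p (hn p hp), ih]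
    obtain ⟨m, hm⟩ := WellFounded.has_min (wellFounded_lt (α := Ordinal.{0}))
      ((fun p => r (t.2.2.2 p)) '' Set.Ici n) ⟨_, n, Set.self_mem_Ici, rfl⟩
    obtain ⟨⟨m, hmn, rfl⟩, hmin⟩ := hm
    have hmn' : n ≤ m := hmn
    have hanti : ∀ p, m ≤ p → r (t.2.2.2 p) ≤ r (t.2.2.2 m) := fun p hp => by
      induction p, hp using Nat.le_induction with
      | base => rfl
      | succ p hp ih => exact (ht.rank_le p (hn p (hmn'.trans hp))).trans ih
    have hoff : ∀ p, m ≤ p → t.2.2.1 p = false → t.2.2.1 (p + 1) = false := by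
      intro p hp h
      by_contra h'
      have := ht.rank_lt p (hn p (hmn'.trans hp)) h (by simpa using h')
      exact hmin _ ⟨p + 1, (hmn'.trans hp).trans (Nat.le_succ p), rfl⟩
        (this.trans_le (hanti p hp))
    by_cases hex : ∃ q, m ≤ q ∧ t.2.2.1 q = false
    · obtain ⟨q, hq, hqf⟩ := hex
      refine ⟨q, 0, fun p hp => ?_⟩
      have : t.2.2.1 p = false := by
        induction p, hp using Nat.le_induction with
        | base => exact hqf
        | succ p hp ih => exact hoff p (hq.trans hp) ih
      simp [coef, this]
    · push Not at hex
      refine ⟨m, t.1 n, fun p hp => ?_⟩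
      have : t.2.2.1 p = true := by simpa using hex p hp
      simp [coef, this, hc p (hmn'.trans hp)]
  · right
    push Not at hfin
    intro ε hε
    have hmono : Monotone fun N => cost t.1 t.2.1 0 N := fun a b h => cost_mono_right _ _ _ h
    have hlim := tendsto_atTop_ciSup hmono ⟨1, by rintro _ ⟨N, rfl⟩; exact ht.cost_le N⟩
    obtain ⟨m, hm⟩ := (hlim.eventually (lt_mem_nhds (sub_lt_self _ (sq_pos_of_pos hε)))).exists
    obtain ⟨p, hp, hps⟩ := hfin m
    refine ⟨p + 1, by simpa using hps, fun N => ?_⟩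
    rcases le_total (p + 1) N with h | h
    · have h1 := cost_add t.1 t.2.1 (Nat.zero_le (p + 1)) h
      have h2 := hmono.ge_of_tendsto hlim N
      have h3 := hmono (show m ≤ p + 1 by omega)
      simp only at h2 h3 hm
      linarith
    · rw [cost, Finset.Ico_eq_empty_of_le h, Finset.sum_empty]
      positivity

end PathSpace

namespace PathSpace

open Filter Topology

variable (r : ℕ → Ordinal.{0})

/-- The `p`-th coefficient, as a continuous function on the path space. -/
def coefMap (p : ℕ) : C(paths r, ℝ) :=
  ⟨fun t => coef t.1 p, (continuous_coef p).comp continuous_subtype_val⟩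

/-- The closed linear span of the coefficient functions. -/
def spaceSubmodule : Submodule ℝ C(paths r, ℝ) :=
  (Submodule.span ℝ (Set.range (coefMap r))).topologicalClosure

/-- The James type space of the path space. -/
def Space : Type := spaceSubmodule r

instance : NormedAddCommGroup (Space r) := Submodule.normedAddCommGroup (spaceSubmodule r)

instance : NormedSpace ℝ (Space r) := Submodule.normedSpace (spaceSubmodule r)

instance : CompleteSpace (Space r) :=
  (Submodule.isClosed_topologicalClosure _).completeSpace_coe

instance : TopologicalSpace.SeparableSpace (Space r) := by
  have : SecondCountableTopology C(paths r, ℝ) := inferInstance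
  have : SecondCountableTopology (Space r) := TopologicalSpace.Subtype.secondCountableTopology _
  infer_instance

variable {r} in
/-- The inclusion of the space into the continuous functions. -/
def toContinuousMap : Space r →ₗ[ℝ] C(paths r, ℝ) := (spaceSubmodule r).subtype

/-- The unit vectors. -/
def unit (p : ℕ) : Space r :=
  ⟨coefMap r p, Submodule.le_topologicalClosure _ (Submodule.subset_span ⟨p, rfl⟩)⟩

/-- The vector with the coordinates `y p` for `m ≤ p < n` and `0` otherwise. -/
def vec (y : ℕ → ℝ) (m n : ℕ) : Space r := ∑ p ∈ Finset.Ico m n, y p • unit r p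

variable {r}

/-- The evaluation at a path. -/
def eval (t : paths r) : StrongDual ℝ (Space r) :=
  ((ContinuousMap.evalCLM ℝ t).comp (spaceSubmodule r).subtypeL : spaceSubmodule r →L[ℝ] ℝ)

@[simp] lemma eval_unit (t : paths r) (p : ℕ) : eval t (unit r p) = coef t.1 p := rfl

lemma eval_vec (t : paths r) (y : ℕ → ℝ) (m n : ℕ) :
    eval t (vec r y m n) = ∑ p ∈ Finset.Ico m n, y p * coef t.1 p := by
  simp [vec]

lemma abs_eval_le (t : paths r) (q : Space r) : |eval t q| ≤ ‖q‖ :=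
  ContinuousMap.norm_coe_le_norm q.1 t

lemma norm_eval_le (t : paths r) : ‖eval t‖ ≤ 1 :=
  ContinuousLinearMap.opNorm_le_bound _ zero_le_one fun q => by
    simpa using abs_eval_le t q

lemma norm_le_of_forall_eval {q : Space r} {C : ℝ} (hC : 0 ≤ C) (h : ∀ t, |eval t q| ≤ C) :
    ‖q‖ ≤ C :=
  (ContinuousMap.norm_le q.1 hC).2 h

lemma exists_eval_eq_norm (q : Space r) : ∃ t, |eval t q| = ‖q‖ := by
  obtain ⟨t, -, ht⟩ := isCompact_univ.exists_isMaxOn Set.univ_nonempty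
    ((map_continuous q.1).abs.continuousOn)
  refine ⟨t, le_antisymm (abs_eval_le t q) (norm_le_of_forall_eval (abs_nonneg _) fun s => ?_)⟩
  exact ht (Set.mem_univ s)

lemma norm_unit_le (p : ℕ) : ‖unit r p‖ ≤ 1 :=
  norm_le_of_forall_eval zero_le_one fun t => abs_coef_le t.2 p

lemma vec_add_vec (y : ℕ → ℝ) {m k n : ℕ} (h : m ≤ k) (h' : k ≤ n) :
    vec r y m k + vec r y k n = vec r y m n :=
  Finset.sum_Ico_consecutive _ h h'

lemma vec_of_zero_right {y : ℕ → ℝ} {m n n' : ℕ} (hn : n ≤ n') (h : ∀ p, n ≤ p → y p = 0) :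
    vec r y m n' = vec r y m n := by
  symm
  refine Finset.sum_subset (Finset.Ico_subset_Ico le_rfl hn) fun p hp hp' => ?_
  rw [h p (by simp at hp hp'; omega), zero_smul]

lemma exists_vec_of_mem_span {x : Space r} (hx : x ∈ Submodule.span ℝ (Set.range (unit r))) :
    ∃ (y : ℕ → ℝ) (N : ℕ), (∀ p, N ≤ p → y p = 0) ∧ x = vec r y 0 N := by
  induction hx using Submodule.span_induction with
  | mem x hx =>
    obtain ⟨p, rfl⟩ := hx
    refine ⟨fun q => if q = p then 1 else 0, p + 1, fun q hq => if_neg (by omega), ?_⟩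
    rw [vec, Finset.sum_eq_single p] <;> simp +contextual
  | zero => exact ⟨0, 0, fun _ _ => rfl, by simp [vec]⟩
  | add x x' _ _ h h' =>
    obtain ⟨y, N, hy, rfl⟩ := h
    obtain ⟨y', N', hy', rfl⟩ := h'
    refine ⟨y + y', max N N', fun p hp => ?_, ?_⟩
    · simp [hy p ((le_max_left _ _).trans hp), hy' p ((le_max_right _ _).trans hp)]
    · rw [← vec_of_zero_right (le_max_left N N') hy, ← vec_of_zero_right (le_max_right N N') hy']
      simp [vec, add_smul, Finset.sum_add_distrib]
  | smul a x _ h =>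
    obtain ⟨y, N, hy, rfl⟩ := h
    refine ⟨a • y, N, fun p hp => by simp [hy p hp], ?_⟩
    simp [vec, Finset.smul_sum, mul_smul]

lemma dense_span_unit : Dense (Submodule.span ℝ (Set.range (unit r)) : Set (Space r)) := by
  intro q
  have hq : q.1 ∈ closure (Submodule.span ℝ (Set.range (coefMap r)) : Set C(paths r, ℝ)) := q.2
  refine closure_subtype.2 (closure_mono ?_ hq)
  have : Submodule.span ℝ (Set.range (coefMap r)) =
      (Submodule.span ℝ (Set.range (unit r))).map toContinuousMap := by
    rw [Submodule.map_span, ← Set.range_comp]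
    rfl
  rw [this]
  rintro _ ⟨x, hx, rfl⟩
  exact ⟨x, hx, rfl⟩

lemma exists_vec_near (q : Space r) {ε : ℝ} (hε : 0 < ε) :
    ∃ (y : ℕ → ℝ) (N : ℕ), ‖q - vec r y 0 N‖ < ε := by
  obtain ⟨x, hx, hqx⟩ := Metric.dense_iff.1 dense_span_unit q ε hε
  obtain ⟨y, N, -, rfl⟩ := exists_vec_of_mem_span hqx
  exact ⟨y, N, by rwa [← dist_eq_norm, dist_comm]⟩

lemma dual_ext {f g : StrongDual ℝ (Space r)} (h : ∀ p, f (unit r p) = g (unit r p)) : f = g := by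
  refine ContinuousLinearMap.ext_on dense_span_unit ?_
  rintro _ ⟨p, rfl⟩
  exact h p

/-- The concatenation of two paths, as points of the path space. -/
def concatPath (n : ℕ) (t₁ t₂ : paths r) {w₁ w₂ : ℝ} (hw : w₁ ^ 2 + w₂ ^ 2 ≤ 1) : paths r :=
  ⟨concat n w₁ w₂ t₁.1 t₂.1, Admissible.concat t₁.2 t₂.2 n hw⟩

lemma eval_concatPath (n : ℕ) (t₁ t₂ : paths r) {w₁ w₂ : ℝ} (hw : w₁ ^ 2 + w₂ ^ 2 ≤ 1)
    (y : ℕ → ℝ) {m k : ℕ} (h : m ≤ n) (h' : n ≤ k) :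
    eval (concatPath n t₁ t₂ hw) (vec r y m k) =
      w₁ * eval t₁ (vec r y m n) + w₂ * eval t₂ (vec r y n k) := by
  rw [← vec_add_vec y h h', map_add, eval_vec, eval_vec, eval_vec, eval_vec, Finset.mul_sum,
    Finset.mul_sum]
  congr 1
  · refine Finset.sum_congr rfl fun p hp => ?_
    have : p < n := (Finset.mem_Ico.1 hp).2
    rw [concatPath, coef_concat, if_pos this]
    ring
  · refine Finset.sum_congr rfl fun p hp => ?_
    have : ¬ p < n := (Finset.mem_Ico.1 hp).1.not_gt
    rw [concatPath, coef_concat, if_neg this]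
    ring

/-- The lower `ℓ²` estimate for successive vectors. -/
lemma sq_norm_add_sq_norm_le (y : ℕ → ℝ) {m k n : ℕ} (h : m ≤ k) (h' : k ≤ n) :
    ‖vec r y m k‖ ^ 2 + ‖vec r y k n‖ ^ 2 ≤ ‖vec r y m n‖ ^ 2 := by
  obtain ⟨t₁, ht₁⟩ := exists_eval_eq_norm (vec r y m k)
  obtain ⟨t₂, ht₂⟩ := exists_eval_eq_norm (vec r y k n)
  rw [← ht₁, ← ht₂, sq_abs, sq_abs]
  set A := eval t₁ (vec r y m k) with hA
  set B := eval t₂ (vec r y k n) with hB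
  rcases eq_or_lt_of_le (add_nonneg (sq_nonneg A) (sq_nonneg B)) with h0 | h0
  · rw [← h0]
    positivity
  set N := √(A ^ 2 + B ^ 2) with hN
  have hN0 : 0 < N := Real.sqrt_pos.2 h0
  have hN2 : N ^ 2 = A ^ 2 + B ^ 2 := Real.sq_sqrt h0.le
  have hw : (A / N) ^ 2 + (B / N) ^ 2 ≤ 1 := by
    rw [div_pow, div_pow, ← add_div, ← hN2, div_self (by positivity)]
  have h1 := eval_concatPath k t₁ t₂ hw y h h'
  have h2 : A / N * A + B / N * B = N := by
    field_simp
    linarith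
  rw [← hA, ← hB, h2] at h1
  have h3 := abs_eval_le (concatPath k t₁ t₂ hw) (vec r y m n)
  rw [h1, abs_of_pos hN0] at h3
  rw [← hN2]
  gcongr

lemma norm_vec_le_right (y : ℕ → ℝ) {m k n : ℕ} (h : m ≤ k) (h' : k ≤ n) :
    ‖vec r y k n‖ ≤ ‖vec r y m n‖ := by
  have h1 := sq_norm_add_sq_norm_le (r := r) y h h'
  have h2 := sq_nonneg ‖vec r y m k‖
  exact le_of_sq_le_sq (by linarith) (norm_nonneg _)

lemma tail_of_path (t : paths r) {ε : ℝ} (hε : 0 < ε) :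
    ∃ n, ∀ (y : ℕ → ℝ) (k N : ℕ), n ≤ k → ∑ p ∈ Finset.Ico k N, y p = 0 →
      |eval t (vec r y k N)| ≤ ε * ‖vec r y k N‖ := by
  rcases Admissible.eventually_const_or t.2 with ⟨n, a, hn⟩ | h
  · refine ⟨n, fun y k N hk hy => ?_⟩
    have : eval t (vec r y k N) = 0 := by
      rw [eval_vec, Finset.sum_congr rfl fun p hp => by
        rw [hn p (hk.trans (Finset.mem_Ico.1 hp).1)], ← Finset.sum_mul, hy, zero_mul]
    rw [this, abs_zero]
    positivity
  · obtain ⟨n, hs, hc⟩ := h ε hε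
    refine ⟨n, fun y k N hk _ => ?_⟩
    set t' : paths r := ⟨_, Admissible.rescale_tail t.2 hs hε hc⟩ with ht'
    have : eval t (vec r y k N) = ε * eval t' (vec r y k N) := by
      rw [eval_vec, eval_vec, Finset.mul_sum]
      refine Finset.sum_congr rfl fun p hp => ?_
      have : ¬ p < n := (hk.trans (Finset.mem_Ico.1 hp).1).not_gt
      rw [ht', coef_concat, if_neg this]
      field_simp
    rw [this, abs_mul, abs_of_pos hε]
    exact mul_le_mul_of_nonneg_left (abs_eval_le _ _) hε.le

end PathSpace

/-- A linear functional on a subspace of `C(K, ℝ)` that is dominated by a multiple of the supremum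
is represented by a positive measure. -/
theorem exists_measure_of_le_sup {K : Type*} [TopologicalSpace K] [CompactSpace K] [T2Space K]
    [Nonempty K] [MeasurableSpace K] [BorelSpace K] (W : Submodule ℝ C(K, ℝ)) (f : W →ₗ[ℝ] ℝ)
    {M : ℝ} (hM : 0 ≤ M) (hf : ∀ (w : W) (C : ℝ), (∀ t, w.1 t ≤ C) → f w ≤ M * C) :
    ∃ μ : MeasureTheory.Measure K, MeasureTheory.IsFiniteMeasure μ ∧
      ∀ w : W, ∫ t, w.1 t ∂μ = f w := by
  have hbdd : ∀ φ : C(K, ℝ), BddAbove (Set.range φ) := fun φ =>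
    (isCompact_range (map_continuous φ)).bddAbove
  obtain ⟨g, hgf, hg⟩ := exists_extension_of_le_sublinear (⟨W, f⟩ : C(K, ℝ) →ₗ.[ℝ] ℝ)
    (fun φ => M * ⨆ t, φ t)
    (by
      intro c hc φ
      simp only [ContinuousMap.smul_apply, smul_eq_mul]
      rw [← Real.mul_iSup_of_nonneg hc.le]
      ring)
    (by
      intro φ ψ
      rw [← mul_add]
      refine mul_le_mul_of_nonneg_left (ciSup_le fun t => ?_) hM
      exact add_le_add (le_ciSup (hbdd φ) t) (le_ciSup (hbdd ψ) t))
    (fun w => hf w _ fun t => le_ciSup (hbdd w.1) t)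
  have hpos : ∀ φ : C(K, ℝ), 0 ≤ φ → 0 ≤ g φ := by
    intro φ hφ
    have h1 := hg (-φ)
    have h2 : (⨆ t, (-φ) t) ≤ 0 := ciSup_le fun t => neg_nonpos.2 (hφ t)
    have h3 := mul_nonpos_of_nonneg_of_nonpos hM h2
    rw [map_neg] at h1
    linarith
  let G : CompactlySupportedContinuousMap K ℝ →ₗ[ℝ] ℝ :=
    { toFun := fun φ => g φ.toContinuousMap
      map_add' := fun φ ψ => g.map_add φ.toContinuousMap ψ.toContinuousMap
      map_smul' := fun c φ => g.map_smul c φ.toContinuousMap }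
  let Λ := PositiveLinearMap.mk₀ G fun φ hφ => hpos _ hφ
  refine ⟨RealRMK.rieszMeasure Λ, inferInstance, fun w => ?_⟩
  have := RealRMK.integral_rieszMeasure Λ (CompactlySupportedContinuousMap.continuousMapEquiv w.1)
  simp only [CompactlySupportedContinuousMap.continuousMapEquiv_apply_toFun] at this
  rw [this]
  exact hgf w

namespace PathSpace

open Filter Topology MeasureTheory

variable {r : ℕ → Ordinal.{0}}

lemma exists_eval_eq_neg (t : paths r) : ∃ t' : paths r, eval t' = -eval t := by
  refine ⟨concatPath 0 t t (w₁ := 0) (w₂ := -1) (by norm_num), dual_ext fun p => ?_⟩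
  change coef (concat _ _ _ _ _) _ = -coef _ _
  simp [coef_concat]

lemma norm_le_of_forall_eval_le {q : Space r} {C : ℝ} (h : ∀ t, eval t q ≤ C) : ‖q‖ ≤ C := by
  obtain ⟨t, ht⟩ := exists_eval_eq_norm q
  obtain ⟨t', ht'⟩ := exists_eval_eq_neg t
  rw [← ht]
  refine abs_le'.2 ⟨h t, ?_⟩
  have := h t'
  rwa [ht'] at this

instance : MeasurableSpace (paths r) := borel _

instance : BorelSpace (paths r) := ⟨rfl⟩

lemma exists_measure_of_dual (f : StrongDual ℝ (Space r)) :
    ∃ μ : Measure (paths r), IsFiniteMeasure μ ∧ ∀ q, ∫ t, eval t q ∂μ = f q := by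
  refine exists_measure_of_le_sup (spaceSubmodule r) (f : Space r →ₗ[ℝ] ℝ) (norm_nonneg f) ?_
  intro w C hC
  have h1 : f w ≤ ‖f‖ * ‖(w : Space r)‖ := (le_abs_self _).trans (f.le_opNorm w)
  exact h1.trans (mul_le_mul_of_nonneg_left (norm_le_of_forall_eval_le hC) (norm_nonneg f))

lemma tail_of_dual (f : StrongDual ℝ (Space r)) {ε : ℝ} (hε : 0 < ε) :
    ∃ n, ∀ (y : ℕ → ℝ) (k N : ℕ), n ≤ k → ∑ p ∈ Finset.Ico k N, y p = 0 →
      |f (vec r y k N)| ≤ ε * ‖vec r y k N‖ := by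
  by_contra! h
  choose y k N hk hy hlt using h
  obtain ⟨μ, hμ, hμf⟩ := exists_measure_of_dual f
  set v : ℕ → Space r := fun n => vec r (y n) (k n) (N n) with hv
  have hpos : ∀ n, 0 < ‖v n‖ := by
    intro n
    by_contra! h0
    have h1 : ‖v n‖ = 0 := le_antisymm h0 (norm_nonneg _)
    have h2 := hlt n
    have h3 := f.le_opNorm (v n)
    rw [h1, mul_zero, Real.norm_eq_abs] at h3
    change ε * ‖v n‖ < |f (v n)| at h2
    rw [h1, mul_zero] at h2
    linarith
  have key : Tendsto (fun n => ∫ t, eval t (‖v n‖⁻¹ • v n) ∂μ) atTop (𝓝 (∫ _, (0 : ℝ) ∂μ)) := by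
    refine tendsto_integral_of_dominated_convergence (fun _ => (1 : ℝ)) (fun n => ?_)
      (integrable_const _) (fun n => ae_of_all _ fun t => ?_) (ae_of_all _ fun t => ?_)
    · exact (map_continuous (toContinuousMap (‖v n‖⁻¹ • v n))).aestronglyMeasurable
    · refine (abs_eval_le t _).trans (le_of_eq ?_)
      rw [norm_smul, norm_inv, norm_norm, inv_mul_cancel₀ (hpos n).ne']
    · rw [Metric.tendsto_atTop]
      intro δ hδ
      obtain ⟨n₀, hn₀⟩ := tail_of_path t (half_pos hδ)
      refine ⟨n₀, fun n hn => ?_⟩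
      have h1 : |eval t (v n)| ≤ δ / 2 * ‖v n‖ := hn₀ _ _ _ (hn.trans (hk n)) (hy n)
      rw [dist_zero_right, map_smul, norm_smul, norm_inv, norm_norm, Real.norm_eq_abs,
        inv_mul_lt_iff₀ (hpos n)]
      nlinarith [hpos n]
  simp only [hμf, integral_zero] at key
  obtain ⟨n, hn⟩ := ((tendsto_order.1 key.abs).2 ε (by simpa using hε)).exists
  rw [map_smul, smul_eq_mul, abs_mul, abs_inv, abs_norm, inv_mul_lt_iff₀ (hpos n)] at hn
  have := hlt n
  rw [mul_comm] at this
  exact lt_asymm hn this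

lemma eval_step_unit (n p : ℕ) : eval (step n : paths r) (unit r p) = if p < n then 0 else 1 :=
  coef_stepPath n p

lemma eval_step_vec (y : ℕ → ℝ) {m n N : ℕ} (h : m ≤ n) (h' : n ≤ N) :
    eval (step n : paths r) (vec r y m N) = ∑ p ∈ Finset.Ico n N, y p := by
  rw [← vec_add_vec y h h', map_add, eval_vec, eval_vec]
  have h1 : ∀ p ∈ Finset.Ico m n, y p * coef (step n : paths r).1 p = 0 := fun p hp => by
    rw [step, coef_stepPath, if_pos (Finset.mem_Ico.1 hp).2, mul_zero]
  have h2 : ∀ p ∈ Finset.Ico n N, y p * coef (step n : paths r).1 p = y p := fun p hp => by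
    rw [step, coef_stepPath, if_neg (Finset.mem_Ico.1 hp).1.not_gt, mul_one]
  rw [Finset.sum_eq_zero h1, Finset.sum_congr rfl h2, zero_add]

variable (r) in
/-- The coordinate functionals. -/
def coord (p : ℕ) : StrongDual ℝ (Space r) := eval (step p) - eval (step (p + 1))

lemma coord_unit (p q : ℕ) : coord r p (unit r q) = if q = p then 1 else 0 := by
  simp only [coord, sub_apply, eval_step_unit]
  split_ifs <;> first | omega | simp

lemma coord_vec (y : ℕ → ℝ) (p m n : ℕ) :
    coord r p (vec r y m n) = if m ≤ p ∧ p < n then y p else 0 := by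
  simp only [vec, map_sum, map_smul, coord_unit, smul_eq_mul, mul_ite, mul_one, mul_zero,
    Finset.sum_ite_eq', Finset.mem_Ico]

lemma norm_le_of_vec {f : StrongDual ℝ (Space r)} {C : ℝ} (hC : 0 ≤ C) (n : ℕ)
    (h : ∀ (y : ℕ → ℝ) (N : ℕ), n ≤ N → |f (vec r y 0 N)| ≤ C * ‖vec r y 0 N‖) : ‖f‖ ≤ C := by
  refine ContinuousLinearMap.opNorm_le_bound _ hC fun q => ?_
  have hcl : IsClosed {q | ‖f q‖ ≤ C * ‖q‖} :=
    isClosed_le (by fun_prop) (by fun_prop)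
  refine closure_minimal ?_ hcl (dense_span_unit q)
  intro x hx
  obtain ⟨y, N, hy, rfl⟩ := exists_vec_of_mem_span hx
  rw [← vec_of_zero_right (le_max_left N n) hy]
  exact h y _ (le_max_right _ _)

/-- The step functionals span a norm dense subspace of the dual. -/
lemma exists_near_dual (f : StrongDual ℝ (Space r)) {ε : ℝ} (hε : 0 < ε) :
    ∃ n, ‖f - (∑ p ∈ Finset.range n, f (unit r p) • coord r p +
      f (unit r n) • eval (step n))‖ ≤ 2 * ε := by
  obtain ⟨n, hn⟩ := tail_of_dual f hε
  refine ⟨n, norm_le_of_vec (by positivity) (n + 1) fun y N hN => ?_⟩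
  have hnN : n ≤ N := by omega
  set a := ∑ p ∈ Finset.Ico n N, y p with ha
  set z : ℕ → ℝ := fun p => y p - if p = n then a else 0 with hz
  have hmem : n ∈ Finset.Ico n N := Finset.mem_Ico.2 ⟨le_rfl, by omega⟩
  have hzvec : vec r z n N = vec r y n N - a • unit r n := by
    simp only [vec, hz, sub_smul, Finset.sum_sub_distrib, ite_smul, zero_smul]
    rw [Finset.sum_ite_eq', if_pos hmem]
  have hzsum : ∑ p ∈ Finset.Ico n N, z p = 0 := by
    simp only [hz, Finset.sum_sub_distrib]
    rw [Finset.sum_ite_eq', if_pos hmem, ha, sub_self]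
  have hstep : eval (step n : paths r) (vec r y 0 N) = a := eval_step_vec y (Nat.zero_le _) hnN
  have heq : (f - (∑ p ∈ Finset.range n, f (unit r p) • coord r p +
      f (unit r n) • eval (step n)) : StrongDual ℝ (Space r)) (vec r y 0 N) = f (vec r z n N) := by
    have hsum : ∑ p ∈ Finset.range n, f (unit r p) * coord r p (vec r y 0 N) =
        f (vec r y 0 n) := by
      simp only [vec, map_sum, map_smul, smul_eq_mul, ← Nat.Ico_zero_eq_range]
      refine Finset.sum_congr rfl fun p hp => ?_
      have := coord_vec (r := r) y p 0 N
      simp only [vec, map_sum, map_smul, smul_eq_mul] at this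
      rw [this, if_pos ⟨Nat.zero_le _, (Finset.mem_Ico.1 hp).2.trans_le hnN⟩, mul_comm]
    simp only [sub_apply, add_apply, _root_.sum_apply, smul_apply, smul_eq_mul,
      hsum, hstep]
    rw [hzvec, map_sub, map_smul, ← vec_add_vec y (Nat.zero_le n) hnN, map_add, smul_eq_mul]
    ring
  rw [heq]
  have h1 : ‖vec r z n N‖ ≤ 2 * ‖vec r y 0 N‖ := by
    rw [hzvec]
    have h2 := norm_vec_le_right (r := r) y (Nat.zero_le n) hnN
    have h3 : |a| ≤ ‖vec r y 0 N‖ := hstep ▸ abs_eval_le _ _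
    have h4 : ‖a • unit r n‖ ≤ ‖vec r y 0 N‖ := by
      rw [norm_smul, Real.norm_eq_abs]
      calc |a| * ‖unit r n‖ ≤ |a| * 1 := by gcongr; exact norm_unit_le n
        _ ≤ _ := by rwa [mul_one]
    linarith [norm_sub_le (vec r y n N) (a • unit r n)]
  calc |f (vec r z n N)| ≤ ε * ‖vec r z n N‖ := hn z n N le_rfl hzsum
    _ ≤ ε * (2 * ‖vec r y 0 N‖) := by gcongr
    _ = 2 * ε * ‖vec r y 0 N‖ := by ring

lemma bidual_eq_zero {Φ : StrongDual ℝ (StrongDual ℝ (Space r))}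
    (h : ∀ n, Φ (eval (step n)) = 0) : Φ = 0 := by
  ext f
  rw [zero_apply, ← abs_nonpos_iff]
  refine le_of_forall_pos_le_add fun ε hε => ?_
  have hε' : 0 < ε / (2 * (‖Φ‖ + 1)) := by positivity
  obtain ⟨n, hn⟩ := exists_near_dual f hε'
  set v := ∑ p ∈ Finset.range n, f (unit r p) • coord r p + f (unit r n) • eval (step n) with hv
  have hΦv : Φ v = 0 := by
    simp [hv, coord, h]
  have h1 : Φ f = Φ (f - v) := by rw [map_sub, hΦv, sub_zero]
  rw [h1, zero_add]
  calc |Φ (f - v)| ≤ ‖Φ‖ * ‖f - v‖ := Φ.le_opNorm _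
    _ ≤ (‖Φ‖ + 1) * (2 * (ε / (2 * (‖Φ‖ + 1)))) := by gcongr; linarith
    _ = ε := by field_simp

end PathSpace

/-- A sequence of values at distance at least `δ` from the value at the limit bounds the oscillation
from below. -/
lemma ofReal_le_oscillationWithin {X : Type*} [TopologicalSpace X] {f : X → ℝ} {D : Set X} {x : X}
    {u : ℕ → X} {δ : ℝ} (hx : x ∈ D) (hu : ∀ n, u n ∈ D)
    (hux : Filter.Tendsto u Filter.atTop (nhds x)) (h : ∀ n, δ ≤ |f (u n) - f x|) :
    ENNReal.ofReal δ ≤ oscillationWithin f D x := by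
  refine le_iInf₂ fun S hS => ?_
  have h1 : Filter.Tendsto u Filter.atTop (nhdsWithin x D) :=
    tendsto_nhdsWithin_iff.2 ⟨hux, Filter.Eventually.of_forall hu⟩
  have hS' : f ⁻¹' S ∈ nhdsWithin x D := hS
  obtain ⟨n, hn⟩ := (h1.eventually hS').exists
  have h2 : x ∈ f ⁻¹' S := mem_of_mem_nhdsWithin hx hS'
  refine le_trans ?_ (Metric.edist_le_ediam_of_mem (x := f (u n)) hn h2)
  rw [edist_dist, Real.dist_eq]
  exact ENNReal.ofReal_le_ofReal (h n)

/-- A bounded sequence has a weak* limit in the bidual along every ultrafilter. -/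
lemma exists_bidual_limit {X : Type*} [NormedAddCommGroup X] [NormedSpace ℝ X] {x : ℕ → X} {C : ℝ}
    (hx : ∀ n, ‖x n‖ ≤ C) (U : Ultrafilter ℕ) : ∃ F : StrongDual ℝ (StrongDual ℝ X),
      ∀ f : StrongDual ℝ X, Filter.Tendsto (fun n => f (x n)) U (nhds (F f)) := by
  let u : ℕ → WeakDual ℝ (StrongDual ℝ X) := fun n =>
    StrongDual.toWeakDual (NormedSpace.inclusionInDoubleDual ℝ X (x n))
  have hu : ∀ n, u n ∈ WeakDual.toStrongDual ⁻¹'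
      Metric.closedBall (0 : StrongDual ℝ (StrongDual ℝ X)) C := fun n => by
    have h : ‖NormedSpace.inclusionInDoubleDual ℝ X (x n)‖ ≤ C :=
      (NormedSpace.double_dual_bound ℝ X (x n)).trans (hx n)
    exact (dist_zero_right (NormedSpace.inclusionInDoubleDual ℝ X (x n))).trans_le h
  obtain ⟨F, -, hF⟩ := (WeakDual.isCompact_closedBall (𝕜 := ℝ)
      (0 : StrongDual ℝ (StrongDual ℝ X)) C).ultrafilter_le_nhds
    (U.map u) (Filter.le_principal_iff.2 (Filter.mem_map.2 (Filter.Eventually.of_forall hu)))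
  exact ⟨WeakDual.toStrongDual F, fun f => ((WeakDual.eval_continuous f).tendsto F).comp hF⟩

namespace PathSpace

open Filter Topology NormedSpace

variable {r : ℕ → Ordinal.{0}}

variable (r) in
lemma exists_limit_functional : ∃ F : StrongDual ℝ (StrongDual ℝ (Space r)),
    ∀ f, Tendsto (fun p => f (unit r p)) (hyperfilter ℕ : Filter ℕ) (𝓝 (F f)) :=
  exists_bidual_limit norm_unit_le _

lemma limit_functional_eq {F : StrongDual ℝ (StrongDual ℝ (Space r))}
    (hF : ∀ f, Tendsto (fun p => f (unit r p)) (hyperfilter ℕ : Filter ℕ) (𝓝 (F f)))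
    {f : StrongDual ℝ (Space r)} {a : ℝ} (n : ℕ) (h : ∀ p, n ≤ p → f (unit r p) = a) :
    F f = a := by
  refine tendsto_nhds_unique (hF f) (tendsto_const_nhds.congr' ?_)
  have : ∀ᶠ p in atTop, a = f (unit r p) := eventually_atTop.2 ⟨n, fun p hp => (h p hp).symm⟩
  exact Nat.hyperfilter_le_atTop this

lemma tendsto_eval_step (q : Space r) :
    Tendsto (fun n => eval (step n : paths r) q) atTop (𝓝 0) := by
  rw [Metric.tendsto_atTop]
  intro ε hε
  obtain ⟨y, N, hN⟩ := exists_vec_near q hε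
  refine ⟨N, fun n hn => ?_⟩
  have h0 : eval (step n : paths r) (vec r y 0 N) = 0 := by
    rw [eval_vec]
    refine Finset.sum_eq_zero fun p hp => ?_
    rw [step, coef_stepPath, if_pos ((Finset.mem_Ico.1 hp).2.trans_le hn), mul_zero]
  rw [dist_zero_right, Real.norm_eq_abs]
  have h1 := abs_eval_le (step n : paths r) (q - vec r y 0 N)
  rw [map_sub, h0, sub_zero] at h1
  exact h1.trans_lt hN

lemma norm_vec_bidual_le (Φ : StrongDual ℝ (StrongDual ℝ (Space r))) (n : ℕ) :
    ‖vec r (fun p => Φ (coord r p)) 0 n‖ ≤ ‖Φ‖ := by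
  refine norm_le_of_forall_eval (norm_nonneg Φ) fun t => ?_
  have h : eval (concatPath n t t (w₁ := 1) (w₂ := 0) (by norm_num)) =
      ∑ p ∈ Finset.Ico 0 n, coef t.1 p • coord r p := by
    refine dual_ext fun q => ?_
    rw [_root_.sum_apply]
    simp only [smul_apply, coord_unit, smul_eq_mul, mul_ite, mul_one, mul_zero]
    rw [Finset.sum_ite_eq]
    simp [concatPath, coef_concat]
  have h' : eval t (vec r (fun p => Φ (coord r p)) 0 n) =
      Φ (eval (concatPath n t t (w₁ := 1) (w₂ := 0) (by norm_num))) := by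
    rw [h, eval_vec, map_sum]
    refine Finset.sum_congr rfl fun p _ => ?_
    rw [map_smul, smul_eq_mul, mul_comm]
  rw [h']
  calc _ ≤ ‖Φ‖ * _ := Φ.le_opNorm _
    _ ≤ ‖Φ‖ * 1 := by gcongr; exact norm_eval_le _
    _ = ‖Φ‖ := mul_one _

/-- The unit vectors form a boundedly complete basis. -/
lemma cauchySeq_vec {y : ℕ → ℝ} {C : ℝ} (h : ∀ n, ‖vec r y 0 n‖ ≤ C) :
    CauchySeq fun n => vec r y 0 n := by
  have hmono : Monotone fun n => ‖vec r y 0 n‖ ^ 2 := fun m n hmn => by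
    have := sq_norm_add_sq_norm_le (r := r) y (Nat.zero_le m) hmn
    have := sq_nonneg ‖vec r y m n‖
    change ‖vec r y 0 m‖ ^ 2 ≤ ‖vec r y 0 n‖ ^ 2
    linarith
  have hlim := tendsto_atTop_ciSup hmono ⟨C ^ 2, by
    rintro _ ⟨n, rfl⟩
    exact pow_le_pow_left₀ (norm_nonneg _) (h n) 2⟩
  rw [Metric.cauchySeq_iff']
  intro ε hε
  obtain ⟨m, hm⟩ := (hlim.eventually (lt_mem_nhds (sub_lt_self _ (sq_pos_of_pos hε)))).exists
  refine ⟨m, fun n hn => ?_⟩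
  rw [dist_eq_norm, ← vec_add_vec y (Nat.zero_le m) hn, add_sub_cancel_left]
  have h1 := sq_norm_add_sq_norm_le (r := r) y (Nat.zero_le m) hn
  have h2 := hmono.ge_of_tendsto hlim n
  exact lt_of_pow_lt_pow_left₀ 2 hε.le (by linarith)

lemma exists_eq_inclusion_add {F : StrongDual ℝ (StrongDual ℝ (Space r))}
    (hF : ∀ f, Tendsto (fun p => f (unit r p)) (hyperfilter ℕ : Filter ℕ) (𝓝 (F f)))
    (Φ : StrongDual ℝ (StrongDual ℝ (Space r))) :
    ∃ (q : Space r) (a : ℝ), Φ = inclusionInDoubleDual ℝ (Space r) q + a • F := by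
  obtain ⟨q, hq⟩ := cauchySeq_tendsto_of_complete (cauchySeq_vec (norm_vec_bidual_le Φ))
  set Ψ := Φ - inclusionInDoubleDual ℝ (Space r) q with hΨ
  have hcoord : ∀ p, Ψ (coord r p) = 0 := by
    intro p
    have h1 : Tendsto (fun n => coord r p (vec r (fun p => Φ (coord r p)) 0 n)) atTop
        (𝓝 (coord r p q)) := ((coord r p).continuous.tendsto q).comp hq
    have h2 : coord r p q = Φ (coord r p) := by
      refine tendsto_nhds_unique h1 (tendsto_const_nhds.congr' ?_)
      filter_upwards [eventually_gt_atTop p] with n hn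
      rw [coord_vec, if_pos ⟨Nat.zero_le _, hn⟩]
    rw [hΨ, sub_apply, dual_def, h2, sub_self]
  have hstep : ∀ n, Ψ (eval (step n)) = Ψ (eval (step 0)) := by
    intro n
    induction n with
    | zero => rfl
    | succ n ih =>
      rw [← ih]
      have := hcoord n
      rw [coord, map_sub] at this
      linarith
  have hFstep : ∀ n, F (eval (step n)) = 1 := fun n =>
    limit_functional_eq hF n fun p hp => by rw [eval_step_unit, if_neg hp.not_gt]
  refine ⟨q, Ψ (eval (step 0)), ?_⟩
  have h0 : Ψ - Ψ (eval (step 0)) • F = 0 := bidual_eq_zero fun n => by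
    rw [sub_apply, smul_apply, hFstep, hstep, smul_eq_mul, mul_one, sub_self]
  ext f
  have h1 := DFunLike.congr_fun h0 f
  rw [sub_apply, zero_apply, hΨ, sub_apply, sub_eq_zero, sub_eq_iff_eq_add'] at h1
  exact h1

lemma isCompl_canonicalImage {F : StrongDual ℝ (StrongDual ℝ (Space r))}
    (hF : ∀ f, Tendsto (fun p => f (unit r p)) (hyperfilter ℕ : Filter ℕ) (𝓝 (F f))) :
    IsCompl (canonicalImage (Space r)) (Submodule.span ℝ {F}) := by
  have hFstep : ∀ n, F (eval (step n)) = 1 := fun n =>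
    limit_functional_eq hF n fun p hp => by rw [eval_step_unit, if_neg hp.not_gt]
  constructor
  · rw [Submodule.disjoint_def]
    rintro x ⟨q, hq⟩ hx
    obtain ⟨a, rfl⟩ := Submodule.mem_span_singleton.1 hx
    have h1 : ∀ n, eval (step n : paths r) q = a := fun n => by
      have := congrArg (fun G : StrongDual ℝ (StrongDual ℝ (Space r)) => G (eval (step n))) hq
      simpa [hFstep] using this
    have h2 := tendsto_eval_step q
    simp only [h1] at h2
    rw [tendsto_nhds_unique tendsto_const_nhds h2, zero_smul]
  · rw [codisjoint_iff, eq_top_iff]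
    intro Φ _
    obtain ⟨q, a, rfl⟩ := exists_eq_inclusion_add hF Φ
    exact Submodule.add_mem_sup ⟨q, rfl⟩
      (Submodule.smul_mem _ _ (Submodule.mem_span_singleton_self F))

lemma limit_functional_ne_zero {F : StrongDual ℝ (StrongDual ℝ (Space r))}
    (hF : ∀ f, Tendsto (fun p => f (unit r p)) (hyperfilter ℕ : Filter ℕ) (𝓝 (F f))) :
    F ≠ 0 := by
  rintro rfl
  have := limit_functional_eq hF (f := eval (step 0)) (a := 1) 0 fun p _ => by
    rw [eval_step_unit, if_neg (by omega)]
  simp at this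

/-- The path is in its last block from `N` on, with weight `1`, and neither the switch nor the label
changes any more. -/
structure Settled (t : PathData) (N : ℕ) : Prop where
  weight : ∀ p, N ≤ p → t.1 p = 1
  not_start : ∀ p, N ≤ p → t.2.1 (p + 1) = false
  switch : ∀ p, N ≤ p → t.2.2.1 p = t.2.2.1 N
  label : ∀ p, N ≤ p → t.2.2.2 p = t.2.2.2 N

/-- Turn the switch at `n`, with the label `j` from there on. -/
def flip (n j : ℕ) (t : PathData) : PathData :=
  (t.1, t.2.1, fun p => if p < n then t.2.2.1 p else !t.2.2.1 p,
    fun p => if p < n then t.2.2.2 p else j)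

lemma Settled.flip {t : PathData} {N n : ℕ} (h : Settled t N) (hn : N ≤ n) (j : ℕ) :
    Settled (flip n j t) n where
  weight p hp := h.weight p (hn.trans hp)
  not_start p hp := h.not_start p (hn.trans hp)
  switch p hp := by
    simp [PathSpace.flip, hp.not_gt, h.switch p (hn.trans hp), h.switch n hn]
  label p hp := by simp [PathSpace.flip, hp.not_gt]

lemma Settled.admissible_flip {t : PathData} {N n j : ℕ} (h : Settled t N) (ht : Admissible r t)
    (hn : N < n) (hj : j ≤ n) (hle : r j ≤ r (t.2.2.2 N))
    (hlt : t.2.2.1 N = false → r j < r (t.2.2.2 N)) : Admissible r (PathSpace.flip n j t) where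
  start := ht.start
  label_le p := by
    by_cases hp : p < n
    · simpa [PathSpace.flip, hp] using ht.label_le p
    · simp only [PathSpace.flip, hp, if_false]
      omega
  cost_le := ht.cost_le
  weight := ht.weight
  rank_le p hp := by
    rcases lt_trichotomy (p + 1) n with h' | h' | h'
    · have : p < n := by omega
      simpa [PathSpace.flip, h', this] using ht.rank_le p hp
    · have h1 : p < n := by omega
      have h2 : N ≤ p := by omega
      simpa [PathSpace.flip, h', h1, h.label p h2] using hle
    · have h1 : ¬ p < n := by omega
      have h2 : ¬ p + 1 < n := by omega
      simp [PathSpace.flip, h1, h2]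
  rank_lt p hp := by
    rcases lt_trichotomy (p + 1) n with h' | h' | h'
    · have : p < n := by omega
      simpa [PathSpace.flip, h', this] using ht.rank_lt p hp
    · have h1 : p < n := by omega
      have h2 : N ≤ p := by omega
      intro h3 _
      simp only [PathSpace.flip, h1, if_true, h.switch p h2] at h3
      simpa [PathSpace.flip, h', h1, h.label p h2] using hlt h3
    · have h1 : ¬ p < n := by omega
      have h2 : ¬ p + 1 < n := by omega
      intro h3 h4
      have h5 : N ≤ p := by omega
      simp [PathSpace.flip, h1, h2, h.switch p h5, h.switch (p + 1) (by omega)] at h3 h4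
      rw [h3] at h4
      exact absurd h4 (by simp)

lemma Settled.coef_flip {t : PathData} {N n : ℕ} (h : Settled t N) (hn : N < n) (j p : ℕ) :
    coef (PathSpace.flip n j t) p =
      coef t p + (if t.2.2.1 N then -1 else 1) * (if p < n then 0 else 1) := by
  by_cases hp : p < n
  · simp [coef, PathSpace.flip, hp]
  · have h1 : N ≤ p := by omega
    cases h2 : t.2.2.1 N <;> simp [coef, PathSpace.flip, hp, h.switch p h1, h.weight p h1, h2]

/-- The evaluation at a path, as a point of the dual ball. -/
def dualPoint (t : paths r) : WeakStarBall (Space r) :=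
  ⟨StrongDual.toWeakDual (eval t), norm_eval_le t⟩

lemma tendsto_dualPoint {u : ℕ → paths r} {t : paths r}
    (h : ∀ q, Tendsto (fun n => eval (u n) q) atTop (𝓝 (eval t q))) :
    Tendsto (fun n => dualPoint (u n)) atTop (𝓝 (dualPoint t)) := by
  rw [tendsto_subtype_rng, tendsto_iff_forall_eval_tendsto_topDualPairing]
  exact h

lemma dualPoint_mem_oscDerivedSet {F : StrongDual ℝ (StrongDual ℝ (Space r))}
    (hF : ∀ f, Tendsto (fun p => f (unit r p)) (hyperfilter ℕ : Filter ℕ) (𝓝 (F f)))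
    (hr : ∀ i, ∀ β ≤ r i, ∃ j, r j = β) (α : Ordinal.{0}) :
    ∀ (t : paths r) (N : ℕ), Settled t.1 N → α ≤ r (t.1.2.2.2 N) →
      dualPoint t ∈ oscDerivedSet (bidualRestrict F) 1 α := by
  induction α using Ordinal.limitRecOn with
  | zero =>
    intro t N _ _
    rw [oscDerivedSet, Ordinal.limitRecOn_zero]
    trivial
  | add_one α ih =>
    intro t N ht hα
    have hα' : α < r (t.1.2.2.2 N) := (lt_add_one α).trans_le hα
    obtain ⟨j, hj, hjle, hjlt⟩ : ∃ j, α ≤ r j ∧ r j ≤ r (t.1.2.2.2 N) ∧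
        (t.1.2.2.1 N = false → r j < r (t.1.2.2.2 N)) := by
      obtain ⟨j, rfl⟩ := hr _ α hα'.le
      exact ⟨j, le_rfl, hα'.le, fun _ => hα'⟩
    set m : ℕ → ℕ := fun n => n + (N + 1 + j) with hm
    let u : ℕ → paths r := fun n => ⟨flip (m n) j t.1,
      ht.admissible_flip t.2 (by simp only [hm]; omega) (by simp only [hm]; omega) hjle hjlt⟩
    set e : ℝ := if t.1.2.2.1 N then -1 else 1 with he
    have hu : ∀ n, eval (u n) = eval t + e • eval (step (m n)) := fun n => dual_ext fun p => by
      simp only [add_apply, smul_apply, smul_eq_mul, eval_unit]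
      exact ht.coef_flip (by simp only [hm]; omega) j p
    have hFstep : ∀ n, F (eval (step n)) = 1 := fun n =>
      limit_functional_eq hF n fun p hp => by rw [eval_step_unit, if_neg hp.not_gt]
    rw [oscDerivedSet, Ordinal.limitRecOn_add_one]
    refine ⟨ih t N ht hα'.le, ?_⟩
    refine ofReal_le_oscillationWithin (u := fun n => dualPoint (u n)) (ih t N ht hα'.le)
      (fun n => ?_) (tendsto_dualPoint fun q => ?_) fun n => ?_
    · refine ih (u n) (m n) (ht.flip (by simp only [hm]; omega) j) ?_
      simpa [u, flip] using hj
    · have h1 : Tendsto (fun n => eval (step (m n) : paths r) q) atTop (𝓝 0) :=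
        (tendsto_eval_step q).comp (tendsto_add_atTop_nat _)
      simpa [hu] using (h1.const_mul e).const_add (eval t q)
    · have h1 : F (eval (u n)) - F (eval t) = e := by
        rw [hu, map_add, map_smul, hFstep, smul_eq_mul, mul_one, add_sub_cancel_left]
      change 1 ≤ |F (eval (u n)) - F (eval t)|
      rw [h1, he]
      split_ifs <;> simp
  | limit α hα ih =>
    intro t N ht hle
    rw [oscDerivedSet, Ordinal.limitRecOn_limit _ _ _ _ hα]
    exact Set.mem_iInter₂.2 fun β hβ => ih β hβ t N ht (hβ.le.trans hle)

lemma exists_settled : ∃ t : paths r, Settled t.1 0 ∧ t.1.2.2.2 0 = 0 := by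
  refine ⟨⟨(fun _ => 1, fun p => p = 0, fun _ => false, fun _ => 0), ?_⟩, ?_, rfl⟩
  · refine ⟨by simp, by simp, fun N => ?_, by simp, by simp, by simp⟩
    simp only [cost, decide_eq_true_eq, one_pow, Finset.sum_ite_eq']
    split_ifs <;> norm_num
  · exact ⟨by simp, by simp, by simp, by simp⟩

end PathSpace

lemma lt_oscIndex_of_nonempty {K : Type*} [TopologicalSpace K] {F : K → ℝ} {δ : ℝ} (hδ : 0 < δ)
    {γ : Ordinal.{0}} (hγ : γ < ω₁) (h : ∀ α ≤ γ, (oscDerivedSet F δ α).Nonempty) :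
    γ < oscIndex F := by
  have hle : ∀ ε, oscIndexAt F ε ≤ ω₁ := fun ε => csInf_le' (Or.inr rfl)
  have h1 : γ < oscIndexAt F δ := by
    have hmem : oscIndexAt F δ ∈ {α : Ordinal.{0} | α < ω₁ ∧ oscDerivedSet F δ α = ∅} ∪ {ω₁} :=
      csInf_mem ⟨ω₁, Or.inr rfl⟩
    rcases hmem with ⟨-, h2⟩ | h2
    · by_contra! h3
      exact (h _ h3).ne_empty h2
    · rw [Set.mem_singleton_iff.1 h2]
      exact hγ
  exact h1.trans_le (le_ciSup (f := fun δ : Set.Ioi (0 : ℝ) => oscIndexAt F δ)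
    ⟨ω₁, by rintro _ ⟨ε, rfl⟩; exact hle ε⟩ ⟨δ, hδ⟩)

lemma exists_ranking {γ : Ordinal.{0}} (hγ : γ < ω₁) :
    ∃ r : ℕ → Ordinal.{0}, r 0 = γ ∧ ∀ i, ∀ β ≤ r i, ∃ j, r j = β := by
  have hc : (Set.Iic γ).Countable := by
    rw [← Set.Iio_insert]
    refine Set.Countable.insert _ ?_
    rw [← Cardinal.le_aleph0_iff_set_countable, Cardinal.mk_Iio_ordinal]
    have : γ.card < Cardinal.aleph 1 := by rwa [← Cardinal.lt_ord, Cardinal.ord_aleph]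
    rw [Cardinal.lt_aleph_one_iff] at this
    rwa [Cardinal.lift_le_aleph0]
  obtain ⟨f, hf⟩ := hc.exists_eq_range ⟨γ, Set.self_mem_Iic⟩
  have hf' : ∀ i, f i ≤ γ := fun i => by
    have : f i ∈ Set.Iic γ := hf ▸ ⟨i, rfl⟩
    exact this
  refine ⟨fun n => Nat.casesOn n γ f, rfl, fun i β hβ => ?_⟩
  have hβγ : β ∈ Set.Iic γ := by
    cases i with
    | zero => exact hβ
    | succ i => exact hβ.trans (hf' i)
  rw [hf] at hβγ
  obtain ⟨j, rfl⟩ := hβγ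
  exact ⟨j + 1, rfl⟩

end

open PathSpace in
theorem proposition2p8 (γ : Ordinal.{0}) (hγ : γ < ω₁) :
    ∃ (Q : Type) (_ : NormedAddCommGroup Q) (_ : NormedSpace ℝ Q),
      CompleteSpace Q ∧ TopologicalSpace.SeparableSpace Q ∧ IsQuasiReflexiveOfOrder Q 1 ∧
      ∃ F : StrongDual ℝ (StrongDual ℝ Q),
        IsCompl (canonicalImage Q) (Submodule.span ℝ {F}) ∧
        γ < oscIndex (bidualRestrict F) := by
  obtain ⟨r, hr0, hr⟩ := exists_ranking hγ
  obtain ⟨F, hF⟩ := exists_limit_functional r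
  have hcompl := isCompl_canonicalImage hF
  refine ⟨Space r, inferInstance, inferInstance, inferInstance, inferInstance, ?_, F, hcompl, ?_⟩
  · rw [IsQuasiReflexiveOfOrder, (Submodule.quotientEquivOfIsCompl _ _ hcompl).rank_eq,
      ← Module.finrank_eq_rank, finrank_span_singleton (limit_functional_ne_zero hF)]
  · obtain ⟨t, ht, ht0⟩ := exists_settled (r := r)
    refine lt_oscIndex_of_nonempty one_pos hγ fun α hα => ⟨dualPoint t, ?_⟩
    exact dualPoint_mem_oscDerivedSet hF hr α t 0 ht (by rwa [ht0, hr0])
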